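/- For an integer $m\ge 1$, a Daubechies filter of order $m$ is a trigonometric polynomial $H_m(\omega)=2^{-1/2}\sum_{\ell=0}^{2m-1}h_m(\ell)e^{i\ell\omega}$ with real coefficients such that $H_m(0)=1$ and $$|H_m(\omega)|^2=\Big(\cos^2\frac{\omega}{2}\Big)^m\sum_{j=0}^{m-1}\binom{m-1+j}{j}\Big(\sin^2\frac{\omega}{2}\Big)^j\qquad(\omega\in\mathbb R).$$ Let $\hat f(\omega)=\frac1{\sqrt{2\pi}}\int_{\mathbb R}f(x)e^{-i\omega x}\,dx$ for $f\in L_1(\mathbb R)$. A Daubechies orthonormal wavelet of order $m$ is a function $\psi_m^D\in L_1(\mathbb R)$ with $$(\psi_m^D)^\wedge(\omega)=e^{-i\omega/2}\,\overline{H_m\Big(\frac\omega2+\pi\Big)}\;\frac1{\sqrt{2\pi}}\prod_{\ell=1}^\infty H_m(2^{-\ell-1}\omega)\qquad(\omega\in\mathbb R)$$ for some Daubechies filter $H_m$ of order $m$. Write $\widehat{{}_k\psi}(\omega)=(i\omega)^{-k}\hat\psi(\omega)$. **Theorem.** Let $k\ge 0$ and $m\ge 2$ be integers with $m>k$, and let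 $\psi_m^D$ be a Daubechies orthonormal wavelet of order $m$. Let $p\in(1,\infty)$, $\varepsilon\in(0,\pi)$ and $c>0$ be real numbers (in particular, $c$ may be the constant of a decay bound $|(\psi_m^D)^\wedge(\omega)|\le\widetilde C|\omega|^{-c\log m}$, $|\omega|>2\pi$, with some $\widetilde C>0$). Then $\widehat{{}_k(\psi_m^D)}\in L_p(\mathbb R)$ and $$B\le\big\|\widehat{{}_k(\psi_m^D)}\big\|_p\le A,$$ where $$A=\frac{(2\pi)^{1/p-1/2}}{\pi^k}\left(\frac{1-2^{1-pk}}{pk-1}\right)^{1/p}+\left[2^{1-p(2m+\frac12)}\pi^{p(m-k-\frac12)+1}\left(\frac{(2m)!}{m!\,(m-1)!}\right)^{p/2}+\frac1{(2\pi)^{cp\log m-2}}+\frac1{2^{p/2-1}\pi^{p(k+\frac12)-1}}\right]^{1/p}$$ and $$B=\frac{(2\pi)^{1/p-1/2}}{\pi^k}\left(\frac{1-2^{1-pk}}{pk-1}\right)^{1/p}-\left[2^{1-p(2m+\frac12)}\varepsilon^{p(m-k-\frac12)+1}\left(\frac{(2m)!}{m!\,(m-1)!}\right)^{p/2}+\frac1{(2\pi)^{cp\log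 m-2}}+\frac1{2^{p/2-1}\pi^{p(k+\frac12)-1}}\right]^{1/p}.$$ -/

import Mathlib

open MeasureTheory

noncomputable section

namespace Daubechies

/-- The trigonometric polynomial `H(ω) = 2^{-1/2} ∑_{ℓ=0}^{2m-1} h(ℓ) e^{iℓω}`. -/
def symbol {m : ℕ} (h : Fin (2 * m) → ℝ) (ω : ℝ) : ℂ :=
  ((Real.sqrt 2)⁻¹ : ℝ) * ∑ l : Fin (2 * m), (h l : ℂ) * Complex.exp (Complex.I * (l : ℕ) * ω)

/-- The polynomial `P_{m-1}(x) = ∑_{j=0}^{m-1} binom(m-1+j, j) x^j`, for `m ≥ 1`. -/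
def daubPoly (m : ℕ) (x : ℝ) : ℝ :=
  ∑ j ∈ Finset.range m, ((m - 1 + j).choose j : ℝ) * x ^ j

/-- `h` is the coefficient sequence of a Daubechies filter of order `m`. The equation at `ω = 0`
only gives `H(0) = ± 1`; the usual normalization `H(0) = 1` is the one for which the infinite
product defining the scaling function converges. -/
structure IsFilter (m : ℕ) (h : Fin (2 * m) → ℝ) : Prop where
  norm_sq : ∀ ω : ℝ, ‖symbol h ω‖ ^ 2
    = (Real.cos (ω / 2) ^ 2) ^ m * daubPoly m (Real.sin (ω / 2) ^ 2)
  at_zero : symbol h 0 = 1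

/-- The Fourier transform `(2π)^{-1/2} ∏_{ℓ ≥ 1} H(2^{-ℓ} ω)` of the scaling function. -/
def scalingHat {m : ℕ} (h : Fin (2 * m) → ℝ) (ω : ℝ) : ℂ :=
  ((Real.sqrt (2 * Real.pi))⁻¹ : ℝ) * ∏' l : ℕ, symbol h (ω / 2 ^ (l + 1))

/-- The Fourier transform `e^{-iω/2} conj(H(ω/2 + π)) φ^(ω/2)` of the wavelet. -/
def waveletHat {m : ℕ} (h : Fin (2 * m) → ℝ) (ω : ℝ) : ℂ :=
  Complex.exp (-(Complex.I * ω / 2)) * (starRingEnd ℂ) (symbol h (ω / 2 + Real.pi))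
    * scalingHat h (ω / 2)

/-- The unitary Fourier transform `f^(ω) = (2π)^{-1/2} ∫ f(x) e^{-iωx} dx`. -/
def fourierHat (f : ℝ → ℂ) (ω : ℝ) : ℂ :=
  ((Real.sqrt (2 * Real.pi))⁻¹ : ℝ) * ∫ x : ℝ, f x * Complex.exp (-(Complex.I * ω * x))

/-- `ψ` is an (orthonormal) Daubechies wavelet of order `m`: an integrable function whose Fourier
transform is the one built from a Daubechies filter of order `m`. -/
def IsWavelet (m : ℕ) (ψ : ℝ → ℂ) : Prop :=
  Integrable ψ ∧ ∃ h : Fin (2 * m) → ℝ, IsFilter m h ∧ ∀ ω : ℝ, fourierHat ψ ω = waveletHat h ω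

/-- The function `(iω)^{-k} f^(ω)`, the Fourier transform of `_k f`. Its value at `ω = 0` is
irrelevant for the `L_p` norm. -/
def primitiveHat (k : ℕ) (f : ℝ → ℂ) (ω : ℝ) : ℂ :=
  ((Complex.I * ω) ^ k)⁻¹ * fourierHat f ω

/-- The main term of both constants. -/
def mainTerm (p : ℝ) (k : ℕ) : ℝ :=
  (2 * Real.pi) ^ (1 / p - 1 / 2) / Real.pi ^ k
    * ((1 - 2 ^ (1 - p * k)) / (p * k - 1)) ^ (1 / p)

/-- The correction bracket, raised to the power `1/p`; `x` is `π` in the upper constant and `ε` in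
the lower one. -/
def correction (p : ℝ) (k m : ℕ) (c x : ℝ) : ℝ :=
  (2 ^ (1 - p * (2 * m + 1 / 2)) * x ^ (p * (m - k - 1 / 2) + 1)
      * (((2 * m).factorial : ℝ) / (m.factorial * (m - 1).factorial)) ^ (p / 2)
    + 1 / (2 * Real.pi) ^ (c * p * Real.log m - 2)
    + 1 / (2 ^ (p / 2 - 1) * Real.pi ^ (p * (k + 1 / 2) - 1))) ^ (1 / p)

/-- The upper constant `A`. -/
def upperConst (p : ℝ) (k m : ℕ) (c : ℝ) : ℝ :=
  mainTerm p k + correction p k m c Real.pi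

/-- The lower constant `B`. -/
def lowerConst (p : ℝ) (k m : ℕ) (c ε : ℝ) : ℝ :=
  mainTerm p k - correction p k m c ε

end Daubechies

end

/-!
Let `W = (2π)^{1/2} |ψ^|` and let `q = |H|`, which by the defining identity depends on the order
`m` only. Since `q ≤ 1`, dropping factors from the infinite product bounds `W` from above, and
`‖(iω)^{-k} ψ^‖_p^p` is estimated separately on three pieces of each half line.

* On `[π, 2π]` the bound `W ≤ 1` gives the `p`-th power of the main term, which is the norm for
  the Shannon wavelet (`lintegral_band_le`).
* On `[0, π]` the zero of order `m` of `H` at `π` gives a quarter of the term of the correction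
  bracket that carries the factorials, at `x = π` (`lintegral_near_zero_le`).
* On `[2π, ∞)` one has `W^p ≤ W`, so that an estimate in `L₁` suffices. On the dyadic block
  `[2^N 2π, 2^{N+1} 2π]` the function `W` is at most `∏_{j ≤ N} q(2^j θ)`, where
  `θ = ω / 2^{N+2} ∈ [π/2, π]`. Integrals of such products are iterates of the transfer operator
  `g ↦ q(t/2) g(t/2) + q(π - t/2) g(π - t/2)` on `[0, π]`, for which `sin²(t/2)` is subinvariant
  with factor `2^{-1/2}` (`transfer_le`). Hence the block integrals decay like `2^{-N/2}`
  (`integral_dyadicProd_block_le`), and they add up to `π (1 + √2)`.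

In units of the last term of the bracket, the pieces add up to at most `J + e^p/4 + 1 + √2`, where
`J` belongs to the main term and `e^p` to the term with the factorials. As `e ≥ 2`
(`two_le_peakConst`), this is at most `J + e^p + 1`, and the subadditivity of `x ↦ x^{1/p}` gives
the upper constant; the term with `c` is only added to the right side.

The subinvariance, uniform in `m`, rests on two facts about `y = |H(π - t/2)|²`: the quadrature
mirror identity `q(t/2)² = 1 - y`, and the monotonicity of `y` in `m` on the stop band, which
reduces the inequality to `m = 2`. Both follow from the recurrence `filterSq_succ` in `m`.

The lower constant is never positive, because the last term of the correction bracket is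
at least the `p`-th power of the main term (`mainTerm_le_correction`).
-/

noncomputable section

namespace Daubechies

/-! ### The polynomial `(1 - x)^m P_{m-1}(x)` -/

lemma one_sub_mul_sum_choose (n M : ℕ) (x : ℝ) :
    (1 - x) * ∑ j ∈ Finset.range (M + 1), ((n + 1 + j).choose j : ℝ) * x ^ j
      = ∑ j ∈ Finset.range (M + 1), ((n + j).choose j : ℝ) * x ^ j
        - ((n + 1 + M).choose M : ℝ) * x ^ (M + 1) := by
  induction M with
  | zero => simp
  | succ M ih =>
    rw [Finset.sum_range_succ, mul_add, ih, Finset.sum_range_succ _ (M + 1)]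
    have h : ((n + 1 + (M + 1)).choose (M + 1) : ℝ)
        = (n + 1 + M).choose M + (n + (M + 1)).choose (M + 1) := by
      have := Nat.choose_succ_succ (n + 1 + M) M
      rw [show n + (M + 1) = n + 1 + M by ring, show n + 1 + (M + 1) = (n + 1 + M).succ by
        simp [Nat.succ_eq_add_one]; ring]
      exact_mod_cast this
    rw [h]
    ring

lemma choose_two_mul_add_two (n : ℕ) :
    (2 * n + 2).choose (n + 1) = 2 * (2 * n + 1).choose (n + 1) := by
  have h := Nat.choose_succ_succ (2 * n + 1) n
  have h' := Nat.choose_symm_half n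
  simp only [Nat.succ_eq_add_one] at h
  rw [show 2 * n + 2 = 2 * n + 1 + 1 by ring, h]
  omega

lemma one_sub_mul_daubPoly (n : ℕ) (x : ℝ) :
    (1 - x) * daubPoly (n + 2) x
      = daubPoly (n + 1) x + ((2 * n + 1).choose (n + 1) : ℝ) * x ^ (n + 1) * (1 - 2 * x) := by
  have h := one_sub_mul_sum_choose n (n + 1) x
  have h2 : ((n + 1 + (n + 1)).choose (n + 1) : ℝ) = 2 * (2 * n + 1).choose (n + 1) := by
    rw [show n + 1 + (n + 1) = 2 * n + 2 by ring]
    exact_mod_cast choose_two_mul_add_two n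
  simp only [daubPoly, show n + 2 - 1 = n + 1 by omega, show n + 1 - 1 = n by omega]
  rw [h, h2, Finset.sum_range_succ, show n + (n + 1) = 2 * n + 1 by ring]
  ring

lemma daubPoly_one_arg (n : ℕ) : daubPoly (n + 1) 1 = (2 * n + 1).choose (n + 1) := by
  have h := one_sub_mul_daubPoly n 1
  norm_num at h
  linarith

lemma daubPoly_nonneg (m : ℕ) {x : ℝ} (hx : 0 ≤ x) : 0 ≤ daubPoly m x :=
  Finset.sum_nonneg fun _ _ => by positivity

lemma daubPoly_le (m : ℕ) {x : ℝ} (hx : 0 ≤ x) (hx1 : x ≤ 1) : daubPoly m x ≤ daubPoly m 1 := by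
  refine Finset.sum_le_sum fun j _ => ?_
  gcongr

/-- The squared modulus `(1 - x)^m P_{m-1}(x)` of a Daubechies filter, in the variable
`x = sin²(ω/2)`. -/
def filterSq (m : ℕ) (x : ℝ) : ℝ := (1 - x) ^ m * daubPoly m x

lemma filterSq_succ (n : ℕ) (x : ℝ) :
    filterSq (n + 2) x = filterSq (n + 1) x
      + ((2 * n + 1).choose (n + 1) : ℝ) * (x * (1 - x)) ^ (n + 1) * (1 - 2 * x) := by
  have h := one_sub_mul_daubPoly n x
  have : filterSq (n + 2) x = (1 - x) ^ (n + 1) * ((1 - x) * daubPoly (n + 2) x) := by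
    simp only [filterSq]; ring
  rw [this, h, filterSq, mul_pow]
  ring

/-- The quadrature mirror identity `|H(ω)|² + |H(ω + π)|² = 1`. -/
lemma filterSq_add_filterSq_one_sub {m : ℕ} (hm : 1 ≤ m) (x : ℝ) :
    filterSq m x + filterSq m (1 - x) = 1 := by
  obtain ⟨n, rfl⟩ := Nat.exists_eq_add_of_le' hm
  induction n with
  | zero => simp [filterSq, daubPoly]
  | succ n ih =>
    have := ih (by omega)
    rw [filterSq_succ, filterSq_succ]
    linear_combination this

lemma filterSq_nonneg (m : ℕ) {x : ℝ} (hx : 0 ≤ x) (hx1 : x ≤ 1) : 0 ≤ filterSq m x :=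
  mul_nonneg (pow_nonneg (by linarith) _) (daubPoly_nonneg m hx)

lemma filterSq_le_one {m : ℕ} (hm : 1 ≤ m) {x : ℝ} (hx : 0 ≤ x) (hx1 : x ≤ 1) :
    filterSq m x ≤ 1 := by
  have h := filterSq_add_filterSq_one_sub hm x
  have h' := filterSq_nonneg m (x := 1 - x) (by linarith) (by linarith)
  linarith

/-- In the stop band the squared modulus decreases with the order, so that the filter of order
`2` dominates all filters of higher order there. -/
lemma filterSq_one_sub_le {m : ℕ} (hm : 2 ≤ m) {x : ℝ} (hx : 0 ≤ x) (hx1 : x ≤ 1 / 2) :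
    filterSq m (1 - x) ≤ x ^ 2 * (3 - 2 * x) := by
  obtain ⟨n, rfl⟩ := Nat.exists_eq_add_of_le' hm
  induction n with
  | zero => simp [filterSq, daubPoly, Finset.sum_range_succ]; linarith
  | succ n ih =>
    have := ih (by omega)
    rw [show n + 1 + 2 = (n + 1) + 2 by ring, filterSq_succ]
    have h : 0 ≤ ((2 * (n + 1) + 1).choose (n + 1 + 1) : ℝ) * ((1 - x) * (1 - (1 - x)))
        ^ (n + 1 + 1) * (2 * (1 - x) - 1) := by
      refine mul_nonneg (mul_nonneg (by positivity) (pow_nonneg ?_ _)) (by linarith)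
      exact mul_nonneg (by linarith) (by linarith)
    rw [show n + 1 + 1 = n + 2 by ring] at *
    linarith

lemma filterSq_one_sub_le_pow (m : ℕ) {x : ℝ} (hx : 0 ≤ x) (hx1 : x ≤ 1) :
    filterSq m (1 - x) ≤ x ^ m * daubPoly m 1 := by
  rw [filterSq, sub_sub_cancel]
  exact mul_le_mul_of_nonneg_left (daubPoly_le m (by linarith) (by linarith)) (by positivity)

/-! ### The growth of the binomial constant -/

/-- The constant `(π/4)^m ((2m)!/(m! (m-1)!))^{1/2}`. Its `p`-th power is the ratio of the first to
the last term of the correction bracket at `x = π`. -/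
def peakConst (m : ℕ) : ℝ :=
  (Real.pi / 4) ^ m * √(((2 * m).factorial : ℝ) / (m.factorial * (m - 1).factorial))

lemma factorial_ratio {m : ℕ} (hm : 1 ≤ m) :
    ((2 * m).factorial : ℝ) / (m.factorial * (m - 1).factorial) = 2 * m * daubPoly m 1 := by
  obtain ⟨n, rfl⟩ := Nat.exists_eq_add_of_le' hm
  rw [daubPoly_one_arg, Nat.cast_choose ℝ (by omega : n + 1 ≤ 2 * n + 1),
    show 2 * n + 1 - (n + 1) = n by omega, show 2 * (n + 1) = (2 * n + 1) + 1 by ring,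
    Nat.factorial_succ (2 * n + 1), Nat.add_sub_cancel]
  push_cast
  ring

lemma two_mul_daubPoly_one_le (n : ℕ) : 2 * daubPoly (n + 1) 1 ≤ daubPoly (n + 2) 1 := by
  rw [daubPoly_one_arg, show n + 2 = (n + 1) + 1 by ring, daubPoly_one_arg]
  have h := choose_two_mul_add_two n
  have h2 := Nat.choose_succ_succ (2 * n + 2) (n + 1)
  simp only [Nat.succ_eq_add_one] at h2
  rw [show 2 * (n + 1) + 1 = 2 * n + 2 + 1 by ring]
  have h3 : 2 * (2 * n + 1).choose (n + 1) ≤ (2 * n + 2 + 1).choose (n + 1 + 1) := by omega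
  exact_mod_cast h3

lemma two_le_peakConst {m : ℕ} (hm : 2 ≤ m) : 2 ≤ peakConst m := by
  have hpi := Real.pi_gt_d2
  have key : 4 ≤ ((Real.pi / 4) ^ 2) ^ m * (2 * m * daubPoly m 1) := by
    obtain ⟨n, rfl⟩ := Nat.exists_eq_add_of_le' hm
    clear hm
    induction n with
    | zero =>
      have h : (3.14 / 4 : ℝ) ^ 4 ≤ (Real.pi / 4) ^ 4 := by gcongr
      norm_num [daubPoly, Finset.sum_range_succ]
      norm_num at h
      nlinarith
    | succ n ih =>
      refine ih.trans ?_
      have h2 := two_mul_daubPoly_one_le (n + 1)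
      have h0 := daubPoly_nonneg (n + 2) (x := 1) (by norm_num)
      rw [show n + 1 + 2 = (n + 2) + 1 by ring, pow_succ ((Real.pi / 4) ^ 2) (n + 2),
        mul_assoc (((Real.pi / 4) ^ 2) ^ (n + 2))]
      refine mul_le_mul_of_nonneg_left ?_ (by positivity)
      have h1 : 1 / 2 ≤ (Real.pi / 4) ^ 2 := by nlinarith
      calc 2 * ((n + 2 : ℕ) : ℝ) * daubPoly (n + 2) 1
          = 1 / 2 * (2 * (n + 2 : ℕ) * (2 * daubPoly (n + 2) 1)) := by ring
        _ ≤ (Real.pi / 4) ^ 2 * (2 * (n + 2 + 1 : ℕ) * daubPoly (n + 2 + 1) 1) := by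
          have h3 : (2 : ℝ) * (n + 2 : ℕ) ≤ 2 * (n + 2 + 1 : ℕ) := by push_cast; linarith
          exact mul_le_mul h1 (mul_le_mul h3 h2 (by positivity) (by positivity))
            (by positivity) (by positivity)
  rw [peakConst, factorial_ratio (by omega)]
  refine le_of_sq_le_sq ?_ (mul_nonneg (by positivity) (Real.sqrt_nonneg _))
  rw [mul_pow, Real.sq_sqrt (mul_nonneg (by positivity) (daubPoly_nonneg m (by norm_num))),
    ← pow_mul, mul_comm m 2, pow_mul]
  linarith

/-! ### The modulus of the filter and its dyadic products -/

/-- The modulus `|H(ω)|` of a Daubechies filter of order `m`; it does not depend on the choice of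
the filter. -/
def gain (m : ℕ) (ω : ℝ) : ℝ := √(filterSq m (Real.sin (ω / 2) ^ 2))

lemma norm_symbol {m : ℕ} {h : Fin (2 * m) → ℝ} (hh : IsFilter m h) (ω : ℝ) :
    ‖symbol h ω‖ = gain m ω := by
  rw [gain, ← Real.sqrt_sq (norm_nonneg _), hh.norm_sq, filterSq, Real.cos_sq']

lemma gain_nonneg (m : ℕ) (ω : ℝ) : 0 ≤ gain m ω := Real.sqrt_nonneg _

lemma gain_le_one {m : ℕ} (hm : 1 ≤ m) (ω : ℝ) : gain m ω ≤ 1 :=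
  Real.sqrt_le_one.mpr (filterSq_le_one hm (sq_nonneg _) (Real.sin_sq_le_one _))

@[fun_prop]
lemma continuous_gain (m : ℕ) : Continuous (gain m) := by
  unfold gain filterSq daubPoly
  fun_prop

lemma gain_neg (m : ℕ) (ω : ℝ) : gain m (-ω) = gain m ω := by
  rw [gain, gain, neg_div, Real.sin_neg, neg_sq]

lemma gain_periodic (m : ℕ) : Function.Periodic (gain m) (2 * Real.pi) := by
  intro ω
  rw [gain, gain, add_div, mul_div_cancel_left₀ _ two_ne_zero, Real.sin_add_pi, neg_sq]

lemma gain_half (m : ℕ) (t : ℝ) : gain m (t / 2) = √(filterSq m (Real.sin (t / 4) ^ 2)) := by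
  rw [gain, div_div]; norm_num

lemma gain_pi_sub_half (m : ℕ) (t : ℝ) :
    gain m (Real.pi - t / 2) = √(filterSq m (1 - Real.sin (t / 4) ^ 2)) := by
  rw [gain, show (Real.pi - t / 2) / 2 = Real.pi / 2 - t / 4 by ring, Real.sin_pi_div_two_sub,
    Real.cos_sq']

lemma gain_half_add_pi (m : ℕ) (ω : ℝ) :
    gain m (ω / 2 + Real.pi) = √(filterSq m (1 - Real.sin (ω / 4) ^ 2)) := by
  rw [gain, show (ω / 2 + Real.pi) / 2 = ω / 4 + Real.pi / 2 by ring, Real.sin_add_pi_div_two,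
    Real.cos_sq']

/-- The dyadic product `|H(θ) H(2θ) ⋯ H(2^{N-1} θ)|`. -/
def dyadicProd (m N : ℕ) (θ : ℝ) : ℝ := ∏ j ∈ Finset.range N, gain m (2 ^ j * θ)

lemma dyadicProd_nonneg (m N : ℕ) (θ : ℝ) : 0 ≤ dyadicProd m N θ :=
  Finset.prod_nonneg fun _ _ => gain_nonneg _ _

lemma dyadicProd_le_one {m : ℕ} (hm : 1 ≤ m) (N : ℕ) (θ : ℝ) : dyadicProd m N θ ≤ 1 :=
  Finset.prod_le_one (fun _ _ => gain_nonneg _ _) fun _ _ => gain_le_one hm _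

lemma dyadicProd_succ (m N : ℕ) (θ : ℝ) :
    dyadicProd m (N + 1) θ = gain m θ * dyadicProd m N (2 * θ) := by
  rw [dyadicProd, Finset.prod_range_succ', mul_comm, dyadicProd]
  congr 1
  · simp
  · exact Finset.prod_congr rfl fun j _ => by rw [pow_succ, mul_assoc]

@[fun_prop]
lemma continuous_dyadicProd (m N : ℕ) : Continuous (dyadicProd m N) := by
  unfold dyadicProd
  fun_prop

lemma dyadicProd_two_pi_sub (m N : ℕ) (θ : ℝ) :
    dyadicProd m N (2 * Real.pi - θ) = dyadicProd m N θ := by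
  refine Finset.prod_congr rfl fun j _ => ?_
  have := (gain_periodic m).nat_mul (2 ^ j) (-(2 ^ j * θ))
  push_cast at this
  rw [mul_sub, ← gain_neg m (2 ^ j * θ), ← this]
  ring_nf

/-! ### The transfer operator -/

lemma integral_gain_mul_reflect (m N : ℕ) (g : ℝ → ℝ) :
    ∫ t in Real.pi..2 * Real.pi, gain m (t / 2) * g (t / 2) * dyadicProd m N t
      = ∫ t in 0..Real.pi,
        gain m (Real.pi - t / 2) * g (Real.pi - t / 2) * dyadicProd m N t := by
  have h := intervalIntegral.integral_comp_sub_left (a := 0) (b := Real.pi)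
    (fun t => gain m (t / 2) * g (t / 2) * dyadicProd m N t) (2 * Real.pi)
  rw [show 2 * Real.pi - Real.pi = Real.pi by ring, sub_zero] at h
  rw [← h]
  refine intervalIntegral.integral_congr fun t _ => ?_
  simp only [dyadicProd_two_pi_sub]
  rw [show (2 * Real.pi - t) / 2 = Real.pi - t / 2 by ring]

/-- Integrating a dyadic product of length `N + 1` against `g` amounts to integrating the product
of length `N` against the image of `g` under the transfer operator
`g ↦ |H(t/2)| g(t/2) + |H(π - t/2)| g(π - t/2)`. -/
lemma two_mul_integral_dyadicProd_succ (m N : ℕ) {g : ℝ → ℝ} (hg : Continuous g) :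
    2 * ∫ t in 0..Real.pi, dyadicProd m (N + 1) t * g t
      = ∫ t in 0..Real.pi, (gain m (t / 2) * g (t / 2)
          + gain m (Real.pi - t / 2) * g (Real.pi - t / 2)) * dyadicProd m N t := by
  set F : ℝ → ℝ := fun t => gain m (t / 2) * g (t / 2) * dyadicProd m N t with hF
  have hFc : Continuous F := by fun_prop
  have h1 : ∫ t in 0..Real.pi, dyadicProd m (N + 1) t * g t = ∫ t in 0..Real.pi, F (2 * t) := by
    refine intervalIntegral.integral_congr fun t _ => ?_
    simp only [hF, dyadicProd_succ]
    rw [mul_div_cancel_left₀ t two_ne_zero]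
    ring
  rw [h1, intervalIntegral.mul_integral_comp_mul_left, mul_zero,
    ← intervalIntegral.integral_add_adjacent_intervals (b := Real.pi)
      (hFc.intervalIntegrable _ _) (hFc.intervalIntegrable _ _), hF,
    integral_gain_mul_reflect m N g, ← intervalIntegral.integral_add]
  · exact intervalIntegral.integral_congr fun t _ => by ring
  · exact hFc.intervalIntegrable _ _
  · exact Continuous.intervalIntegrable (by fun_prop) _ _

lemma sin_sq_quarter_le_half {t : ℝ} (h0 : 0 ≤ t) (h1 : t ≤ Real.pi) :
    Real.sin (t / 4) ^ 2 ≤ 1 / 2 := by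
  have := Real.cos_nonneg_of_mem_Icc (x := t / 2) ⟨by linarith [Real.pi_pos], by linarith⟩
  rw [show t / 2 = 2 * (t / 4) by ring, Real.cos_two_mul, Real.cos_sq'] at this
  linarith

lemma sin_sq_half (t : ℝ) :
    Real.sin (t / 2) ^ 2 = 4 * (Real.sin (t / 4) ^ 2 * (1 - Real.sin (t / 4) ^ 2)) := by
  rw [← Real.cos_sq', show t / 2 = 2 * (t / 4) by ring, Real.sin_two_mul]
  ring

lemma two_mul_sqrt_two : (√2)⁻¹ * 4 = 2 * √2 := by
  have : √2 ≠ 0 := by positivity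
  field_simp
  nlinarith [Real.sq_sqrt (show (0 : ℝ) ≤ 2 by norm_num)]

lemma sqrt_filterSq_one_sub_le {m : ℕ} (hm : 2 ≤ m) {x : ℝ} (hx : 0 ≤ x) (hx1 : x ≤ 1 / 2) :
    √(filterSq m (1 - x)) ≤ x * √(3 - 2 * x) := by
  refine Real.sqrt_le_iff.mpr ⟨by positivity, ?_⟩
  rw [mul_pow, Real.sq_sqrt (by linarith)]
  exact filterSq_one_sub_le hm hx hx1

lemma gain_pi_sub_half_le {m : ℕ} (hm : 2 ≤ m) {t : ℝ} (h0 : 0 ≤ t) (h1 : t ≤ Real.pi) :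
    gain m (Real.pi - t / 2) ≤ (√2)⁻¹ * Real.sin (t / 2) ^ 2 := by
  have hx1 := sin_sq_quarter_le_half h0 h1
  have hx := sq_nonneg (Real.sin (t / 4))
  rw [gain_pi_sub_half, sin_sq_half, ← mul_assoc, two_mul_sqrt_two]
  generalize Real.sin (t / 4) ^ 2 = x at *
  refine (sqrt_filterSq_one_sub_le hm hx hx1).trans ?_
  have : √(3 - 2 * x) ≤ 2 * √2 * (1 - x) := by
    refine Real.sqrt_le_iff.mpr ⟨mul_nonneg (by positivity) (by linarith), ?_⟩
    rw [mul_pow, mul_pow, Real.sq_sqrt (by norm_num)]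
    nlinarith
  calc x * √(3 - 2 * x) ≤ x * (2 * √2 * (1 - x)) := by gcongr
    _ = _ := by ring

/-- The function `sin²(t/2)` is subinvariant for the transfer operator, with factor `2^{-1/2}`.
By the quadrature mirror identity the left side is an increasing function of `|H(π - t/2)|²` on
`[0, 1/2]`, so that the order `m = 2` is the worst. -/
lemma transfer_le {m : ℕ} (hm : 2 ≤ m) {t : ℝ} (h0 : 0 ≤ t) (h1 : t ≤ Real.pi) :
    gain m (t / 2) * Real.sin (t / 2 / 2) ^ 2
      + gain m (Real.pi - t / 2) * Real.sin ((Real.pi - t / 2) / 2) ^ 2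
      ≤ (√2)⁻¹ * Real.sin (t / 2) ^ 2 := by
  have hx1 := sin_sq_quarter_le_half h0 h1
  have hx := sq_nonneg (Real.sin (t / 4))
  rw [gain_half, gain_pi_sub_half, sin_sq_half t, ← mul_assoc (√2)⁻¹, two_mul_sqrt_two,
    show (Real.pi - t / 2) / 2 = Real.pi / 2 - t / 4 by ring, Real.sin_pi_div_two_sub,
    Real.cos_sq', show t / 2 / 2 = t / 4 by ring]
  generalize Real.sin (t / 4) ^ 2 = x at *
  have hq := filterSq_add_filterSq_one_sub (show 1 ≤ m by omega) x
  have hy0 := filterSq_nonneg m (x := 1 - x) (by linarith) (by linarith)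
  have hyY := filterSq_one_sub_le hm hx hx1
  have hsS := sqrt_filterSq_one_sub_le hm hx hx1
  have hc2 : √(filterSq m x) ^ 2 = filterSq m x :=
    Real.sq_sqrt (filterSq_nonneg m hx (by linarith))
  have hs2 : √(filterSq m (1 - x)) ^ 2 = filterSq m (1 - x) := Real.sq_sqrt hy0
  have hc0 := Real.sqrt_nonneg (filterSq m x)
  have hs0 := Real.sqrt_nonneg (filterSq m (1 - x))
  set c := √(filterSq m x)
  set s := √(filterSq m (1 - x))
  have hA2 : √(1 + 2 * x) ^ 2 = 1 + 2 * x := Real.sq_sqrt (by linarith)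
  have hB2 : √(3 - 2 * x) ^ 2 = 3 - 2 * x := Real.sq_sqrt (by linarith)
  have hA0 : 0 < √(1 + 2 * x) := Real.sqrt_pos.mpr (by linarith)
  have hB0 : 0 < √(3 - 2 * x) := Real.sqrt_pos.mpr (by linarith)
  -- `C` and `S` are the values of `c` and `s` for `m = 2`.
  set C := (1 - x) * √(1 + 2 * x) with hC
  set S := x * √(3 - 2 * x) with hS
  have hS2 : S ^ 2 = x ^ 2 * (3 - 2 * x) := by rw [hS, mul_pow, hB2]
  have hC2 : C ^ 2 = 1 - x ^ 2 * (3 - 2 * x) := by rw [hC, mul_pow, hA2]; ring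
  have hY : x ^ 2 * (3 - 2 * x) ≤ 1 / 2 := by nlinarith [mul_nonneg hx (sub_nonneg.mpr hx1)]
  have hC0 : 0 < C := mul_pos (by linarith) hA0
  have hsc : s ≤ c := le_of_sq_le_sq (by rw [hc2, hs2]; linarith) hc0
  have hSC : S ≤ C := le_of_sq_le_sq (by rw [hC2, hS2]; linarith) hC0.le
  have hcC : c - C ≤ S - s := by
    refine le_of_mul_le_mul_right (a := c + C) ?_ (by linarith)
    calc (c - C) * (c + C) = (S - s) * (S + s) := by linear_combination hc2 - hC2 - hS2 + hs2 + hq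
      _ ≤ (S - s) * (c + C) := mul_le_mul_of_nonneg_left (by linarith) (by linarith)
  have hAB : √(1 + 2 * x) + √(3 - 2 * x) ≤ 2 * √2 := by
    refine le_of_sq_le_sq ?_ (by positivity)
    rw [mul_pow, Real.sq_sqrt (by norm_num)]
    nlinarith [sq_nonneg (√(1 + 2 * x) - √(3 - 2 * x))]
  calc c * x + s * (1 - x) ≤ C * x + S * (1 - x) := by nlinarith
    _ = (√(1 + 2 * x) + √(3 - 2 * x)) * (x * (1 - x)) := by rw [hC, hS]; ring
    _ ≤ 2 * √2 * (x * (1 - x)) :=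
      mul_le_mul_of_nonneg_right hAB (mul_nonneg hx (by linarith))

lemma integral_sin_sq_half : ∫ t in 0..Real.pi, Real.sin (t / 2) ^ 2 = Real.pi / 2 := by
  rw [intervalIntegral.integral_comp_div (fun t => Real.sin t ^ 2) two_ne_zero, integral_sin_sq]
  simp
  ring

lemma integral_dyadicProd_mul_sin_sq_le {m : ℕ} (hm : 2 ≤ m) (N : ℕ) :
    2 ^ N * ∫ t in 0..Real.pi, dyadicProd m N t * Real.sin (t / 2) ^ 2
      ≤ (√2)⁻¹ ^ N * (Real.pi / 2) := by
  induction N with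
  | zero => simp [dyadicProd, integral_sin_sq_half]
  | succ N ih =>
    rw [pow_succ 2, mul_assoc, two_mul_integral_dyadicProd_succ m N (by fun_prop)]
    calc _ ≤ 2 ^ N * ∫ t in 0..Real.pi,
          (√2)⁻¹ * (dyadicProd m N t * Real.sin (t / 2) ^ 2) := by
          refine mul_le_mul_of_nonneg_left ?_ (by positivity)
          refine intervalIntegral.integral_mono_on Real.pi_pos.le
            (Continuous.intervalIntegrable (by fun_prop) _ _)
            (Continuous.intervalIntegrable (by fun_prop) _ _) fun t ht => ?_
          calc _ ≤ ((√2)⁻¹ * Real.sin (t / 2) ^ 2) * dyadicProd m N t :=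
                mul_le_mul_of_nonneg_right (transfer_le hm ht.1 ht.2) (dyadicProd_nonneg _ _ _)
            _ = _ := by ring
      _ = (√2)⁻¹ * (2 ^ N * ∫ t in 0..Real.pi, dyadicProd m N t * Real.sin (t / 2) ^ 2) := by
          rw [intervalIntegral.integral_const_mul]; ring
      _ ≤ (√2)⁻¹ * ((√2)⁻¹ ^ N * (Real.pi / 2)) := by gcongr
      _ = _ := by ring

/-- The decay of the wavelet in the `L₁` mean over the dyadic blocks. Reflection turns
the factor `|H(t/2)|` on `[π, 2π]` into `|H(π - t/2)|`, which is at most `2^{-1/2} sin²(t/2)`. -/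
lemma integral_dyadicProd_block_le {m : ℕ} (hm : 2 ≤ m) (N : ℕ) :
    ∫ ω in 2 ^ N * (2 * Real.pi)..2 ^ (N + 1) * (2 * Real.pi),
      dyadicProd m (N + 1) (ω / 2 ^ (N + 2)) ≤ Real.pi * (√2)⁻¹ ^ (N + 1) := by
  have h2 : (2 : ℝ) ^ (N + 1) ≠ 0 := by positivity
  have e1 : ∫ ω in 2 ^ N * (2 * Real.pi)..2 ^ (N + 1) * (2 * Real.pi),
      dyadicProd m (N + 1) (ω / 2 ^ (N + 2))
      = 2 ^ (N + 1) * ∫ t in Real.pi..2 * Real.pi, gain m (t / 2) * 1 * dyadicProd m N t := by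
    have := intervalIntegral.integral_comp_div (a := 2 ^ N * (2 * Real.pi))
      (b := 2 ^ (N + 1) * (2 * Real.pi))
      (fun t => gain m (t / 2) * 1 * dyadicProd m N t) h2
    rw [mul_div_cancel_left₀ _ h2, show 2 ^ N * (2 * Real.pi) / 2 ^ (N + 1) = Real.pi by
      field_simp; ring, smul_eq_mul] at this
    rw [← this]
    refine intervalIntegral.integral_congr fun t _ => ?_
    simp only [dyadicProd_succ]
    congr 2
    · rw [mul_one]; congr 1; field_simp; ring
    · field_simp; ring
  rw [e1, integral_gain_mul_reflect m N fun _ => 1]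
  calc _ ≤ 2 ^ (N + 1) * ∫ t in 0..Real.pi,
          (√2)⁻¹ * (dyadicProd m N t * Real.sin (t / 2) ^ 2) := by
          refine mul_le_mul_of_nonneg_left ?_ (by positivity)
          refine intervalIntegral.integral_mono_on Real.pi_pos.le
            (Continuous.intervalIntegrable (by fun_prop) _ _)
            (Continuous.intervalIntegrable (by fun_prop) _ _) fun t ht => ?_
          calc _ ≤ ((√2)⁻¹ * Real.sin (t / 2) ^ 2) * dyadicProd m N t := by
                rw [mul_one]
                exact mul_le_mul_of_nonneg_right (gain_pi_sub_half_le hm ht.1 ht.2)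
                  (dyadicProd_nonneg _ _ _)
            _ = _ := by ring
    _ = 2 * (√2)⁻¹ * (2 ^ N * ∫ t in 0..Real.pi,
          dyadicProd m N t * Real.sin (t / 2) ^ 2) := by
        rw [intervalIntegral.integral_const_mul]; ring
    _ ≤ 2 * (√2)⁻¹ * ((√2)⁻¹ ^ N * (Real.pi / 2)) := by
        exact mul_le_mul_of_nonneg_left (integral_dyadicProd_mul_sin_sq_le hm N) (by positivity)
    _ = _ := by ring

/-! ### Pointwise bounds for the wavelet -/

lemma norm_symbol_sub_one_le {m : ℕ} {h : Fin (2 * m) → ℝ} (hh : IsFilter m h) (ω : ℝ) :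
    ‖symbol h ω - 1‖ ≤ ((√2)⁻¹ * ∑ l : Fin (2 * m), |h l| * (l : ℕ)) * |ω| := by
  rw [← hh.at_zero, symbol, symbol, ← mul_sub, ← Finset.sum_sub_distrib, norm_mul,
    Complex.norm_real, Real.norm_of_nonneg (by positivity), mul_assoc, Finset.sum_mul]
  refine mul_le_mul_of_nonneg_left (norm_sum_le_of_le _ fun l _ => ?_) (by positivity)
  have := Real.norm_exp_I_mul_ofReal_sub_one_le (x := (l : ℕ) * ω)
  rw [norm_mul, Real.norm_eq_abs, Real.norm_eq_abs, Nat.abs_cast] at this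
  simp only [Complex.ofReal_zero, mul_zero, Complex.exp_zero]
  rw [← mul_sub, norm_mul, Complex.norm_real, Real.norm_eq_abs, mul_assoc |h l|]
  refine mul_le_mul_of_nonneg_left ?_ (abs_nonneg _)
  push_cast at this
  rwa [← mul_assoc] at this

/-- The infinite product converges, so that `∏'` is its genuine value. -/
lemma multipliable_symbol {m : ℕ} {h : Fin (2 * m) → ℝ} (hh : IsFilter m h) (ω : ℝ) :
    Multipliable fun l : ℕ => symbol h (ω / 2 ^ (l + 1)) := by
  have key : Summable fun l : ℕ => ‖symbol h (ω / 2 ^ (l + 1)) - 1‖ := by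
    refine Summable.of_nonneg_of_le (fun _ => norm_nonneg _)
      (fun l => norm_symbol_sub_one_le hh _) ?_
    refine Summable.mul_left _ ?_
    have : ∀ l : ℕ, |ω / 2 ^ (l + 1)| = |ω| / 2 * (1 / 2) ^ l := fun l => by
      rw [abs_div, abs_of_pos (show (0 : ℝ) < 2 ^ (l + 1) by positivity), pow_succ, one_div,
        inv_pow]
      field_simp
    simp only [this]
    exact summable_geometric_two.mul_left _
  simpa using multipliable_one_add_of_summable key

lemma prod_gain_div_two_pow (m N : ℕ) (ω : ℝ) :
    ∏ l ∈ Finset.range N, gain m (ω / 2 ^ (l + 1)) = dyadicProd m N (ω / 2 ^ N) := by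
  induction N with
  | zero => simp [dyadicProd]
  | succ N ih =>
    rw [Finset.prod_range_succ, ih, dyadicProd_succ, mul_comm]
    congr 2
    field_simp
    ring

lemma norm_scalingHat_le {m : ℕ} (hm : 1 ≤ m) {h : Fin (2 * m) → ℝ} (hh : IsFilter m h)
    (N : ℕ) (ω : ℝ) :
    ‖scalingHat h ω‖ ≤ (√(2 * Real.pi))⁻¹ * dyadicProd m N (ω / 2 ^ N) := by
  rw [scalingHat, norm_mul, Complex.norm_real, Real.norm_of_nonneg (by positivity)]
  refine mul_le_mul_of_nonneg_left ?_ (by positivity)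
  have ht := (multipliable_symbol hh ω).hasProd.tendsto_prod_nat.norm
  refine le_of_tendsto ht (Filter.eventually_atTop.mpr ⟨N, fun M hM => ?_⟩)
  rw [norm_prod, ← prod_gain_div_two_pow]
  simp only [norm_symbol hh]
  exact Finset.prod_le_prod_of_subset_of_le_one (Finset.range_mono hM)
    (fun _ _ => gain_nonneg _ _) (fun _ _ _ => gain_le_one hm _)

lemma norm_waveletHat {m : ℕ} {h : Fin (2 * m) → ℝ} (hh : IsFilter m h) (ω : ℝ) :
    ‖waveletHat h ω‖ = gain m (ω / 2 + Real.pi) * ‖scalingHat h (ω / 2)‖ := by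
  rw [waveletHat, norm_mul, norm_mul, RCLike.norm_conj, norm_symbol hh,
    show -(Complex.I * ω / 2) = ((-(ω / 2) : ℝ) : ℂ) * Complex.I by push_cast; ring,
    Complex.norm_exp_ofReal_mul_I, one_mul]

lemma norm_waveletHat_le_dyadicProd {m : ℕ} (hm : 1 ≤ m) {h : Fin (2 * m) → ℝ}
    (hh : IsFilter m h) (N : ℕ) (ω : ℝ) :
    ‖waveletHat h ω‖ ≤ (√(2 * Real.pi))⁻¹ * dyadicProd m N (ω / 2 ^ (N + 1)) := by
  have hs := norm_scalingHat_le hm hh N (ω / 2)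
  rw [div_div, ← pow_succ'] at hs
  rw [norm_waveletHat hh]
  exact (mul_le_of_le_one_left (norm_nonneg _) (gain_le_one hm _)).trans hs

lemma gain_half_add_pi_le (m : ℕ) (ω : ℝ) :
    gain m (ω / 2 + Real.pi) ≤ (|ω| / 4) ^ m * √(daubPoly m 1) := by
  have hs : Real.sin (ω / 4) ^ 2 ≤ (|ω| / 4) ^ 2 := by
    have := Real.abs_sin_le_abs (x := ω / 4)
    rw [abs_div, abs_of_pos (show (0 : ℝ) < 4 by norm_num)] at this
    rw [← sq_abs (Real.sin _)]
    gcongr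
  rw [gain_half_add_pi]
  refine Real.sqrt_le_iff.mpr ⟨by positivity, ?_⟩
  refine (filterSq_one_sub_le_pow m (sq_nonneg _) (Real.sin_sq_le_one _)).trans ?_
  rw [mul_pow, Real.sq_sqrt (daubPoly_nonneg m zero_le_one), pow_right_comm (|ω| / 4) m 2]
  exact mul_le_mul_of_nonneg_right (pow_le_pow_left₀ (sq_nonneg _) hs m)
    (daubPoly_nonneg m zero_le_one)

/-- Near the origin the wavelet vanishes to the order `m`. -/
lemma norm_waveletHat_le_pow {m : ℕ} (hm : 1 ≤ m) {h : Fin (2 * m) → ℝ} (hh : IsFilter m h)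
    (ω : ℝ) :
    ‖waveletHat h ω‖ ≤ (√(2 * Real.pi))⁻¹ * ((|ω| / 4) ^ m * √(daubPoly m 1)) := by
  have hs := norm_scalingHat_le hm hh 0 (ω / 2)
  simp only [dyadicProd, Finset.range_zero, Finset.prod_empty, mul_one] at hs
  rw [norm_waveletHat hh, mul_comm]
  exact mul_le_mul hs (gain_half_add_pi_le m ω) (gain_nonneg _ _) (by positivity)

/-- The value `(2π)^{-1/2} π^{-k}` at `ω = π` of `|(iω)^{-k} ψ^(ω)|` for the Shannon wavelet `ψ`. -/
def edgeValue (k : ℕ) : ℝ := (√(2 * Real.pi))⁻¹ * (Real.pi ^ k)⁻¹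

lemma edgeValue_pos (k : ℕ) : 0 < edgeValue k := by
  unfold edgeValue
  have := Real.pi_pos
  positivity

lemma norm_primitiveHat {m : ℕ} {ψ : ℝ → ℂ} {h : Fin (2 * m) → ℝ}
    (hψ : ∀ ω, fourierHat ψ ω = waveletHat h ω) (k : ℕ) (ω : ℝ) :
    ‖primitiveHat k ψ ω‖ = (|ω| ^ k)⁻¹ * ‖waveletHat h ω‖ := by
  rw [primitiveHat, norm_mul, norm_inv, norm_pow, norm_mul, Complex.norm_I, one_mul,
    Complex.norm_real, Real.norm_eq_abs, hψ]

lemma inv_pow_mul_pow_mul_sqrt_le {k m : ℕ} (hm : 2 ≤ m) (hkm : k < m) {r : ℝ} (h0 : 0 < r)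
    (h1 : r ≤ Real.pi) :
    (r ^ k)⁻¹ * ((r / 4) ^ m * √(daubPoly m 1))
      ≤ (Real.pi ^ k)⁻¹ * (r / Real.pi * (peakConst m / 2)) := by
  have hpi := Real.pi_pos
  obtain ⟨d, hd⟩ := Nat.exists_eq_add_of_lt hkm
  have hr : (r / Real.pi) ^ (d + 1) ≤ r / Real.pi :=
    pow_le_of_le_one (by positivity) ((div_le_one hpi).mpr h1) (by omega)
  have hs : 2 * √(daubPoly m 1) ≤ √(2 * m * daubPoly m 1) := by
    rw [Real.sqrt_mul (by positivity)]
    refine mul_le_mul_of_nonneg_right (Real.le_sqrt_of_sq_le ?_) (Real.sqrt_nonneg _)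
    have : (2 : ℝ) ≤ m := by exact_mod_cast hm
    linarith
  have hs' : √(daubPoly m 1) ≤ √(2 * m * daubPoly m 1) / 2 := by linarith
  rw [peakConst, factorial_ratio (by omega)]
  calc (r ^ k)⁻¹ * ((r / 4) ^ m * √(daubPoly m 1))
      = (Real.pi ^ k)⁻¹ * ((r / Real.pi) ^ (d + 1) * ((Real.pi / 4) ^ m * √(daubPoly m 1))) := by
        generalize √(daubPoly m 1) = q
        rw [hd]
        simp only [div_pow, pow_add, pow_one]
        field_simp
    _ ≤ (Real.pi ^ k)⁻¹
          * (r / Real.pi * ((Real.pi / 4) ^ m * (√(2 * m * daubPoly m 1) / 2))) := by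
        gcongr
    _ = _ := by ring

/-! ### The integral over a half line -/

lemma setLIntegral_Icc_le_ofReal {F φ : ℝ → ℝ} {a b : ℝ} (hab : a ≤ b)
    (hφ : ContinuousOn φ (Set.Icc a b)) (h0 : ∀ ω ∈ Set.Ioc a b, 0 ≤ φ ω)
    (hF : ∀ ω ∈ Set.Ioc a b, F ω ≤ φ ω) :
    ∫⁻ ω in Set.Icc a b, ENNReal.ofReal (F ω) ≤ ENNReal.ofReal (∫ ω in a..b, φ ω) := by
  rw [intervalIntegral.integral_of_le hab, setLIntegral_congr Ioc_ae_eq_Icc.symm,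
    ofReal_integral_eq_lintegral_ofReal
      ((hφ.integrableOn_Icc).mono_set Set.Ioc_subset_Icc_self)
      ((ae_restrict_iff' measurableSet_Ioc).mpr (Filter.Eventually.of_forall h0))]
  exact setLIntegral_mono' measurableSet_Ioc fun ω hω => ENNReal.ofReal_le_ofReal (hF ω hω)

/-- The value `∫_1^2 x^{-pk} dx`, which enters the main term. -/
def shannonInt (p : ℝ) (k : ℕ) : ℝ := (1 - 2 ^ (1 - p * k)) / (p * k - 1)

lemma mul_natCast_ne_one {p : ℝ} (hp : 1 < p) (k : ℕ) : p * k ≠ 1 := by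
  rcases Nat.eq_zero_or_pos k with rfl | hk
  · simp
  · have : (1 : ℝ) ≤ k := by exact_mod_cast hk
    nlinarith

lemma integral_rpow_pi_two_pi {p : ℝ} (hp : 1 < p) (k : ℕ) :
    ∫ ω in Real.pi..2 * Real.pi, ω ^ (-(p * k))
      = Real.pi * Real.pi ^ (-(p * k)) * shannonInt p k := by
  have hpi := Real.pi_pos
  have h1 := mul_natCast_ne_one hp k
  rw [integral_rpow (Or.inr ⟨fun h => h1 (by linarith), ?_⟩), shannonInt,
    Real.mul_rpow (by norm_num) hpi.le, Real.rpow_add_one hpi.ne',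
    show -(p * k) + 1 = 1 - p * k by ring]
  · have h2 : p * k - 1 ≠ 0 := sub_ne_zero.mpr h1
    have h3 : 1 - p * k ≠ 0 := sub_ne_zero.mpr h1.symm
    field_simp
    ring
  · rw [Set.uIcc_of_le (by linarith), Set.mem_Icc, not_and_or]
    exact Or.inl (by linarith)

lemma shannonInt_nonneg {p : ℝ} (hp : 1 < p) (k : ℕ) : 0 ≤ shannonInt p k := by
  have hpi := Real.pi_pos
  have h : 0 ≤ ∫ ω in Real.pi..2 * Real.pi, ω ^ (-(p * k)) :=
    intervalIntegral.integral_nonneg (by linarith) fun ω hω =>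
      Real.rpow_nonneg (hpi.le.trans hω.1) _
  rw [integral_rpow_pi_two_pi hp] at h
  exact nonneg_of_mul_nonneg_right h (by positivity)

lemma shannonInt_le_one {p : ℝ} (hp : 1 < p) (k : ℕ) : shannonInt p k ≤ 1 := by
  rcases Nat.eq_zero_or_pos k with rfl | hk
  · norm_num [shannonInt]
  · have hk1 : (1 : ℝ) ≤ k := by exact_mod_cast hk
    have hpk : 0 < p * k - 1 := by nlinarith
    rw [shannonInt, div_le_one hpk]
    have h := Real.add_one_le_exp (Real.log 2 * (1 - p * k))
    rw [← Real.rpow_def_of_pos (by norm_num)] at h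
    have hl := Real.log_two_lt_d9
    nlinarith

lemma edgeValue_rpow {p : ℝ} (k : ℕ) :
    edgeValue k ^ p = (√(2 * Real.pi))⁻¹ ^ p * Real.pi ^ (-(p * k)) := by
  have hpi := Real.pi_pos
  rw [edgeValue, Real.mul_rpow (by positivity) (by positivity), ← Real.rpow_natCast,
    ← Real.rpow_neg hpi.le, ← Real.rpow_mul hpi.le]
  ring_nf

lemma lintegral_near_zero_le {p : ℝ} (hp : 1 < p) {k m : ℕ} (hm : 2 ≤ m) {F : ℝ → ℝ}
    (hF0 : ∀ ω, 0 ≤ F ω)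
    (hF : ∀ ω, 0 < ω → ω ≤ Real.pi → F ω ≤ edgeValue k * (ω / Real.pi * (peakConst m / 2))) :
    ∫⁻ ω in Set.Icc 0 Real.pi, ENNReal.ofReal (F ω ^ p)
      ≤ ENNReal.ofReal (edgeValue k ^ p * Real.pi * (peakConst m ^ p / 4)) := by
  have hpi := Real.pi_pos
  have hA := edgeValue_pos k
  have he : 0 < peakConst m := two_pos.trans_le (two_le_peakConst hm)
  have h2 : (2 : ℝ) ≤ 2 ^ p := by
    simpa using Real.rpow_le_rpow_of_exponent_le (x := 2) (by norm_num) hp.le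
  refine (setLIntegral_Icc_le_ofReal (φ := fun ω =>
    edgeValue k ^ p * (peakConst m ^ p / 2) / Real.pi * ω) hpi.le (by fun_prop)
    (fun ω hω => mul_nonneg (by positivity) hω.1.le) fun ω hω => ?_).trans_eq ?_
  · have hr0 : 0 ≤ ω / Real.pi := div_nonneg hω.1.le hpi.le
    have hr : (ω / Real.pi) ^ p ≤ ω / Real.pi := by
      simpa using Real.rpow_le_rpow_of_exponent_ge' hr0 ((div_le_one hpi).mpr hω.2)
        zero_le_one hp.le
    calc F ω ^ p ≤ (edgeValue k * (ω / Real.pi * (peakConst m / 2))) ^ p :=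
          Real.rpow_le_rpow (hF0 ω) (hF ω hω.1 hω.2) (by linarith)
      _ = edgeValue k ^ p * ((ω / Real.pi) ^ p * (peakConst m ^ p / 2 ^ p)) := by
          rw [Real.mul_rpow hA.le (by positivity), Real.mul_rpow hr0 (by positivity),
            Real.div_rpow he.le (by norm_num)]
      _ ≤ edgeValue k ^ p * (ω / Real.pi * (peakConst m ^ p / 2)) := by gcongr
      _ = _ := by ring
  · rw [intervalIntegral.integral_const_mul, integral_id]
    congr 1
    field_simp
    ring

lemma lintegral_band_le {p : ℝ} (hp : 1 < p) {k : ℕ} {F : ℝ → ℝ} (hF0 : ∀ ω, 0 ≤ F ω)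
    (hF : ∀ ω, 0 < ω → F ω ≤ (√(2 * Real.pi))⁻¹ * (ω ^ k)⁻¹) :
    ∫⁻ ω in Set.Icc Real.pi (2 * Real.pi), ENNReal.ofReal (F ω ^ p)
      ≤ ENNReal.ofReal (edgeValue k ^ p * Real.pi * shannonInt p k) := by
  have hpi := Real.pi_pos
  refine (setLIntegral_Icc_le_ofReal (φ := fun ω =>
    (√(2 * Real.pi))⁻¹ ^ p * ω ^ (-(p * k))) (by linarith) ?_ ?_ fun ω hω => ?_).trans_eq ?_
  · refine continuousOn_const.mul (continuousOn_id.rpow_const fun ω hω => Or.inl ?_)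
    exact (hpi.trans_le hω.1).ne'
  · exact fun ω hω => mul_nonneg (by positivity) (Real.rpow_nonneg (hpi.trans hω.1).le _)
  · have hω0 := hpi.trans hω.1
    refine (Real.rpow_le_rpow (hF0 ω) (hF ω hω0) (by linarith)).trans_eq ?_
    rw [Real.mul_rpow (by positivity) (by positivity), ← Real.rpow_natCast,
      ← Real.rpow_neg hω0.le, ← Real.rpow_mul hω0.le]
    ring_nf
  · rw [intervalIntegral.integral_const_mul, integral_rpow_pi_two_pi hp, edgeValue_rpow]
    congr 1
    ring

lemma lintegral_block_le {p : ℝ} (hp : 1 < p) {k m : ℕ} (hm : 2 ≤ m) {F : ℝ → ℝ}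
    (hF0 : ∀ ω, 0 ≤ F ω)
    (hF : ∀ N ω, 0 < ω →
      F ω ≤ (√(2 * Real.pi))⁻¹ * (ω ^ k)⁻¹ * dyadicProd m N (ω / 2 ^ (N + 1))) (N : ℕ) :
    ∫⁻ ω in Set.Icc (2 ^ N * (2 * Real.pi)) (2 ^ (N + 1) * (2 * Real.pi)),
      ENNReal.ofReal (F ω ^ p)
      ≤ ENNReal.ofReal (edgeValue k ^ p * Real.pi * (√2)⁻¹ ^ (N + 1)) := by
  have hpi := Real.pi_pos
  have hA := edgeValue_pos k
  refine (setLIntegral_Icc_le_ofReal (φ := fun ω =>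
    edgeValue k ^ p * dyadicProd m (N + 1) (ω / 2 ^ (N + 2))) ?_ (by fun_prop)
    (fun ω _ => mul_nonneg (by positivity) (dyadicProd_nonneg _ _ _)) fun ω hω => ?_).trans
    (ENNReal.ofReal_le_ofReal ?_)
  · exact mul_le_mul_of_nonneg_right (pow_le_pow_right₀ (by norm_num) (by omega)) (by positivity)
  · have h1 : (1 : ℝ) ≤ 2 ^ N := one_le_pow₀ (by norm_num)
    have hω1 : Real.pi ≤ ω := by nlinarith [hω.1]
    have hω0 := hpi.trans_le hω1
    have hW0 := dyadicProd_nonneg m (N + 1) (ω / 2 ^ (N + 2))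
    -- The product is at most `1`, so its `L₁` bound serves for every `p`.
    have hW : dyadicProd m (N + 1) (ω / 2 ^ (N + 2)) ^ p
        ≤ dyadicProd m (N + 1) (ω / 2 ^ (N + 2)) := by
      simpa using Real.rpow_le_rpow_of_exponent_ge' hW0 (dyadicProd_le_one (by omega) _ _)
        zero_le_one hp.le
    calc F ω ^ p ≤ (edgeValue k * dyadicProd m (N + 1) (ω / 2 ^ (N + 2))) ^ p := by
          refine Real.rpow_le_rpow (hF0 ω) ((hF (N + 1) ω hω0).trans ?_) (by linarith)
          rw [edgeValue]
          gcongr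
      _ = edgeValue k ^ p * dyadicProd m (N + 1) (ω / 2 ^ (N + 2)) ^ p :=
          Real.mul_rpow hA.le hW0
      _ ≤ _ := by gcongr
  · rw [intervalIntegral.integral_const_mul, mul_assoc]
    exact mul_le_mul_of_nonneg_left (integral_dyadicProd_block_le hm N) (by positivity)

lemma inv_sqrt_two_lt_one : (√2)⁻¹ < 1 :=
  inv_lt_one_of_one_lt₀ (Real.lt_sqrt_of_sq_lt (by norm_num))

lemma hasSum_inv_sqrt_two_pow : HasSum (fun N : ℕ => (√2)⁻¹ ^ (N + 1)) (1 + √2) := by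
  have h := (hasSum_geometric_of_lt_one (by positivity) inv_sqrt_two_lt_one).mul_left (√2)⁻¹
  have h2 : √2 ^ 2 = 2 := Real.sq_sqrt (by norm_num)
  have h1 : 1 < √2 := Real.lt_sqrt_of_sq_lt (by norm_num)
  have : (√2)⁻¹ * (1 - (√2)⁻¹)⁻¹ = 1 + √2 := by
    have h3 : √2 - 1 ≠ 0 := by linarith
    field_simp
    nlinarith
  rw [this] at h
  simpa only [pow_succ'] using h

lemma lintegral_Ioi_le {p : ℝ} (hp : 1 < p) {k m : ℕ} (hm : 2 ≤ m) {F : ℝ → ℝ}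
    (hF0 : ∀ ω, 0 ≤ F ω)
    (hF1 : ∀ ω, 0 < ω → ω ≤ Real.pi → F ω ≤ edgeValue k * (ω / Real.pi * (peakConst m / 2)))
    (hF : ∀ N ω, 0 < ω →
      F ω ≤ (√(2 * Real.pi))⁻¹ * (ω ^ k)⁻¹ * dyadicProd m N (ω / 2 ^ (N + 1))) :
    ∫⁻ ω in Set.Ioi 0, ENNReal.ofReal (F ω ^ p)
      ≤ ENNReal.ofReal (edgeValue k ^ p * Real.pi
        * (shannonInt p k + (peakConst m ^ p + 1))) := by
  have hpi := Real.pi_pos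
  have hA := edgeValue_pos k
  have he := two_le_peakConst hm
  have hJ := shannonInt_nonneg hp k
  have hcover : Set.Ioi (0 : ℝ) ⊆ Set.Icc 0 Real.pi ∪ (Set.Icc Real.pi (2 * Real.pi)
      ∪ ⋃ N : ℕ, Set.Icc (2 ^ N * (2 * Real.pi)) (2 ^ (N + 1) * (2 * Real.pi))) := by
    intro ω hω
    rcases le_total ω Real.pi with h | h
    · exact Or.inl ⟨le_of_lt hω, h⟩
    rcases le_total ω (2 * Real.pi) with h' | h'
    · exact Or.inr (Or.inl ⟨h, h'⟩)
    obtain ⟨N, hN1, hN2⟩ := exists_nat_pow_near (x := ω / (2 * Real.pi)) (y := 2)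
      ((one_le_div (by positivity)).mpr h') one_lt_two
    refine Or.inr (Or.inr (Set.mem_iUnion.mpr ⟨N, ?_, ?_⟩))
    · exact (le_div_iff₀ (by positivity)).mp hN1
    · exact ((div_lt_iff₀ (by positivity)).mp hN2).le
  have htail : ∫⁻ ω in ⋃ N : ℕ, Set.Icc (2 ^ N * (2 * Real.pi)) (2 ^ (N + 1) * (2 * Real.pi)),
      ENNReal.ofReal (F ω ^ p) ≤ ENNReal.ofReal (edgeValue k ^ p * Real.pi * (1 + √2)) := by
    have hs := hasSum_inv_sqrt_two_pow.mul_left (edgeValue k ^ p * Real.pi)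
    rw [← hs.tsum_eq, ENNReal.ofReal_tsum_of_nonneg (fun _ => by positivity) hs.summable]
    exact (lintegral_iUnion_le _ _).trans
      (ENNReal.tsum_le_tsum fun N => lintegral_block_le hp hm hF0 hF N)
  have hband := lintegral_band_le hp (k := k) hF0 fun ω hω => by
    simpa [dyadicProd] using hF 0 ω hω
  have hzero := lintegral_near_zero_le hp hm hF0 hF1
  refine (lintegral_mono_set hcover).trans ((lintegral_union_le _ _ _).trans ?_)
  refine (add_le_add hzero ((lintegral_union_le _ _ _).trans (add_le_add hband htail))).trans ?_
  rw [← ENNReal.ofReal_add (by positivity) (by positivity),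
    ← ENNReal.ofReal_add (by positivity) (by positivity), ← mul_add, ← mul_add]
  refine ENNReal.ofReal_le_ofReal (mul_le_mul_of_nonneg_left ?_ (by positivity))
  have hep : peakConst m ≤ peakConst m ^ p := by
    simpa using Real.rpow_le_rpow_of_exponent_le (x := peakConst m) (by linarith) hp.le
  have h2 : √2 ≤ 3 / 2 := Real.sqrt_le_iff.mpr (by norm_num)
  linarith

/-! ### The norm and the two constants -/

lemma continuous_fourierHat {f : ℝ → ℂ} (hf : Integrable f) : Continuous (fourierHat f) := by
  unfold fourierHat
  refine continuous_const.mul (continuous_of_dominated (bound := fun x => ‖f x‖) (fun ω => ?_)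
    (fun ω => Filter.Eventually.of_forall fun x => ?_) hf.norm
    (Filter.Eventually.of_forall fun x => by fun_prop))
  · exact hf.aestronglyMeasurable.mul (Continuous.aestronglyMeasurable (by fun_prop))
  · rw [norm_mul, show -(Complex.I * ω * x) = ((-(ω * x) : ℝ) : ℂ) * Complex.I by
      push_cast; ring, Complex.norm_exp_ofReal_mul_I, mul_one]

lemma measurable_primitiveHat {f : ℝ → ℂ} (hf : Integrable f) (k : ℕ) :
    Measurable (primitiveHat k f) := by
  have := (continuous_fourierHat hf).measurable
  unfold primitiveHat
  fun_prop

lemma lintegral_le_of_halfLines {G : ℝ → ENNReal} {a : ENNReal}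
    (h1 : ∫⁻ ω in Set.Ioi 0, G ω ≤ a) (h2 : ∫⁻ ω in Set.Ioi 0, G (-ω) ≤ a) :
    ∫⁻ ω, G ω ≤ 2 * a := by
  rw [← lintegral_add_compl G (A := Set.Ioi 0) measurableSet_Ioi, two_mul, Set.compl_Ioi]
  refine add_le_add h1 ?_
  have h := (Measure.measurePreserving_neg (volume : Measure ℝ)).setLIntegral_comp_preimage_emb
    (Homeomorph.neg ℝ).measurableEmbedding G (Set.Iio 0)
  rw [setLIntegral_congr Iio_ae_eq_Iic.symm, ← h]
  simpa using h2

/-- The `p`-th power of the `L_p` norm is at most `2π (edgeValue k)^p (J + e^p + 1)`, where `J` is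
`shannonInt p k` and `e` is `peakConst m`. -/
lemma lintegral_primitiveHat_le {k m : ℕ} (hm : 2 ≤ m) (hkm : k < m) {p : ℝ} (hp : 1 < p)
    {ψ : ℝ → ℂ} (hψ : IsWavelet m ψ) :
    ∫⁻ ω, ENNReal.ofReal (‖primitiveHat k ψ ω‖ ^ p)
      ≤ ENNReal.ofReal (2 * Real.pi * edgeValue k ^ p
        * (shannonInt p k + (peakConst m ^ p + 1))) := by
  obtain ⟨-, h, hh, hψh⟩ := hψ
  have hm1 : 1 ≤ m := by omega
  have hnear : ∀ ω : ℝ, 0 < |ω| → |ω| ≤ Real.pi →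
      ‖primitiveHat k ψ ω‖ ≤ edgeValue k * (|ω| / Real.pi * (peakConst m / 2)) := by
    intro ω h0 h1
    rw [norm_primitiveHat hψh, edgeValue, mul_assoc]
    calc _ ≤ (|ω| ^ k)⁻¹ * ((√(2 * Real.pi))⁻¹ * ((|ω| / 4) ^ m * √(daubPoly m 1))) :=
          mul_le_mul_of_nonneg_left (norm_waveletHat_le_pow hm1 hh ω) (by positivity)
      _ = (√(2 * Real.pi))⁻¹ * ((|ω| ^ k)⁻¹ * ((|ω| / 4) ^ m * √(daubPoly m 1))) := by ring
      _ ≤ _ := mul_le_mul_of_nonneg_left (inv_pow_mul_pow_mul_sqrt_le hm hkm h0 h1)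
          (by positivity)
  have hfar : ∀ N (ω : ℝ), ‖primitiveHat k ψ ω‖
      ≤ (√(2 * Real.pi))⁻¹ * (|ω| ^ k)⁻¹ * dyadicProd m N (ω / 2 ^ (N + 1)) := by
    intro N ω
    rw [norm_primitiveHat hψh]
    calc _ ≤ (|ω| ^ k)⁻¹ * ((√(2 * Real.pi))⁻¹ * dyadicProd m N (ω / 2 ^ (N + 1))) :=
          mul_le_mul_of_nonneg_left (norm_waveletHat_le_dyadicProd hm1 hh N ω) (by positivity)
      _ = _ := by ring
  have heven : ∀ N (θ : ℝ), dyadicProd m N (-θ) = dyadicProd m N θ := fun N θ =>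
    Finset.prod_congr rfl fun j _ => by rw [mul_neg, gain_neg]
  have key := lintegral_le_of_halfLines
    (lintegral_Ioi_le hp (k := k) hm (F := fun ω => ‖primitiveHat k ψ ω‖)
      (fun _ => norm_nonneg _)
      (fun ω h0 h1 => by
        have := hnear ω
        rw [abs_of_pos h0] at this
        exact this h0 h1)
      fun N ω h0 => by simpa [abs_of_pos h0] using hfar N ω)
    (lintegral_Ioi_le hp (k := k) hm (F := fun ω => ‖primitiveHat k ψ (-ω)‖)
      (fun _ => norm_nonneg _)
      (fun ω h0 h1 => by
        have := hnear (-ω)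
        rw [abs_neg, abs_of_pos h0] at this
        exact this h0 h1)
      fun N ω h0 => by simpa [abs_of_pos h0, neg_div, heven] using hfar N (-ω))
  refine key.trans_eq ?_
  rw [← ENNReal.ofReal_ofNat, ← ENNReal.ofReal_mul (by norm_num)]
  congr 1
  ring

lemma two_pi_mul_edgeValue_rpow (p : ℝ) (k : ℕ) :
    2 * Real.pi * edgeValue k ^ p = (2 * Real.pi) ^ (1 - p / 2) * Real.pi ^ (-(p * k)) := by
  have hpi := Real.pi_pos
  have h2 : 0 < 2 * Real.pi := by positivity
  rw [edgeValue_rpow, Real.sqrt_eq_rpow, ← Real.rpow_neg h2.le, ← Real.rpow_mul h2.le,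
    sub_eq_add_neg, Real.rpow_add h2, Real.rpow_one, mul_assoc]
  ring_nf

lemma mainTerm_eq {p : ℝ} (hp : 1 < p) (k : ℕ) :
    mainTerm p k = (2 * Real.pi * edgeValue k ^ p * shannonInt p k) ^ (1 / p) := by
  have hpi := Real.pi_pos
  have h2 : 0 < 2 * Real.pi := by positivity
  have hp0 : p ≠ 0 := by linarith
  rw [Real.mul_rpow (by have := edgeValue_pos k; positivity) (shannonInt_nonneg hp k),
    two_pi_mul_edgeValue_rpow, Real.mul_rpow (by positivity) (by positivity),
    ← Real.rpow_mul h2.le, ← Real.rpow_mul hpi.le, mainTerm, shannonInt, div_eq_mul_inv _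
    (Real.pi ^ k), ← Real.rpow_natCast, ← Real.rpow_neg hpi.le]
  congr 3
  · field_simp
  · field_simp

/-- The last term of the correction bracket. -/
lemma correction_edge_term_eq (p : ℝ) (k : ℕ) :
    1 / (2 ^ (p / 2 - 1) * Real.pi ^ (p * (k + 1 / 2) - 1)) = 2 * Real.pi * edgeValue k ^ p := by
  have hpi := Real.pi_pos
  rw [two_pi_mul_edgeValue_rpow, Real.mul_rpow (by norm_num) hpi.le, mul_assoc,
    ← Real.rpow_add hpi, one_div, mul_inv, ← Real.rpow_neg (by norm_num), ← Real.rpow_neg hpi.le]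
  congr 2 <;> ring

/-- The first term of the correction bracket at `x = π`. -/
lemma correction_peak_term_eq (p : ℝ) (k m : ℕ) :
    2 ^ (1 - p * (2 * m + 1 / 2)) * Real.pi ^ (p * (m - k - 1 / 2) + 1)
      * (((2 * m).factorial : ℝ) / (m.factorial * (m - 1).factorial)) ^ (p / 2)
      = 2 * Real.pi * edgeValue k ^ p * peakConst m ^ p := by
  have hpi := Real.pi_pos
  rw [two_pi_mul_edgeValue_rpow, peakConst,
    Real.mul_rpow (x := (Real.pi / 4) ^ m) (by positivity) (by positivity),
    Real.sqrt_eq_rpow, ← Real.rpow_mul (by positivity), ← mul_assoc,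
    show 1 / 2 * p = p / 2 by ring]
  congr 1
  have h4 : (4 : ℝ) = 2 ^ (2 : ℝ) := by norm_num
  rw [← Real.rpow_natCast, ← Real.rpow_mul (by positivity), Real.div_rpow hpi.le (by norm_num),
    h4, ← Real.rpow_mul (by norm_num), div_eq_mul_inv (Real.pi ^ ((m : ℝ) * p)),
    ← Real.rpow_neg (by norm_num),
    Real.mul_rpow (by norm_num) hpi.le]
  calc _ = 2 ^ ((1 - p / 2) + -(2 * (m * p)))
        * Real.pi ^ ((1 - p / 2) + -(p * k) + m * p) := by congr 2 <;> ring
    _ = _ := by rw [Real.rpow_add (by norm_num), Real.rpow_add hpi, Real.rpow_add hpi]; ring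

lemma correction_pi_ge {p : ℝ} (hp : 1 < p) {k m : ℕ} (hm : 2 ≤ m) (c : ℝ) :
    (2 * Real.pi * edgeValue k ^ p * (peakConst m ^ p + 1)) ^ (1 / p)
      ≤ correction p k m c Real.pi := by
  have hpi := Real.pi_pos
  have hA := edgeValue_pos k
  have he := two_le_peakConst hm
  rw [correction, correction_peak_term_eq, correction_edge_term_eq]
  refine Real.rpow_le_rpow (by positivity) ?_ (by positivity)
  have : 0 ≤ 1 / (2 * Real.pi) ^ (c * p * Real.log m - 2) := by positivity
  linarith

lemma mainTerm_le_correction {p : ℝ} (hp : 1 < p) (k m : ℕ) (c : ℝ) {x : ℝ} (hx : 0 < x) :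
    mainTerm p k ≤ correction p k m c x := by
  have hpi := Real.pi_pos
  have hA := edgeValue_pos k
  have hJ := shannonInt_nonneg hp k
  have hJ1 := shannonInt_le_one hp k
  rw [mainTerm_eq hp, correction, correction_edge_term_eq]
  refine Real.rpow_le_rpow (by positivity) ?_ (by positivity)
  refine (mul_le_of_le_one_right (by positivity) hJ1).trans (le_add_of_nonneg_left ?_)
  positivity

end Daubechies
end

theorem theorem1 (k m : ℕ) (hm : 2 ≤ m) (hkm : k < m) (p : ℝ) (hp : 1 < p)
    (c : ℝ) (hc : 0 < c) (ε : ℝ) (hε : 0 < ε) (hεπ : ε < Real.pi)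
    (ψ : ℝ → ℂ) (hψ : Daubechies.IsWavelet m ψ) :
    MemLp (Daubechies.primitiveHat k ψ) (ENNReal.ofReal p) volume ∧
    Daubechies.lowerConst p k m c ε
      ≤ (eLpNorm (Daubechies.primitiveHat k ψ) (ENNReal.ofReal p) volume).toReal ∧
    (eLpNorm (Daubechies.primitiveHat k ψ) (ENNReal.ofReal p) volume).toReal
      ≤ Daubechies.upperConst p k m c := by
  have hp0 : 0 < p := by linarith
  have hA := Daubechies.edgeValue_pos k
  have hpi := Real.pi_pos
  have he := Daubechies.two_le_peakConst hm
  have hJ := Daubechies.shannonInt_nonneg hp k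
  set b : ℝ := 2 * Real.pi * Daubechies.edgeValue k ^ p
    * (Daubechies.shannonInt p k + (Daubechies.peakConst m ^ p + 1)) with hb
  have hb0 : 0 ≤ b := by positivity
  have hnorm : eLpNorm (Daubechies.primitiveHat k ψ) (ENNReal.ofReal p) volume
      ≤ ENNReal.ofReal (b ^ (1 / p)) := by
    rw [eLpNorm_eq_lintegral_rpow_enorm_toReal (by simpa using hp0) ENNReal.ofReal_ne_top,
      ENNReal.toReal_ofReal hp0.le, ← ENNReal.ofReal_rpow_of_nonneg hb0 (by positivity)]
    refine ENNReal.rpow_le_rpow ?_ (by positivity)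
    refine le_trans (le_of_eq (lintegral_congr fun ω => ?_))
      (Daubechies.lintegral_primitiveHat_le hm hkm hp hψ)
    rw [← ENNReal.ofReal_rpow_of_nonneg (norm_nonneg _) hp0.le, ofReal_norm]
  refine ⟨⟨(Daubechies.measurable_primitiveHat hψ.1 k).aestronglyMeasurable,
    hnorm.trans_lt ENNReal.ofReal_lt_top⟩, ?_, ?_⟩
  · -- The last term of the bracket alone, to the power `1/p`, bounds the main term,
    -- so that the lower constant is `≤ 0`.
    rw [Daubechies.lowerConst]
    have := Daubechies.mainTerm_le_correction hp k m c hε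
    have h0 := ENNReal.toReal_nonneg
      (a := eLpNorm (Daubechies.primitiveHat k ψ) (ENNReal.ofReal p) volume)
    linarith
  · refine (ENNReal.toReal_le_of_le_ofReal (by positivity) hnorm).trans ?_
    rw [hb, mul_add]
    refine (Real.rpow_add_le_add_rpow (by positivity) (by positivity) (by positivity)
      ((div_le_one hp0).mpr hp.le)).trans ?_
    rw [Daubechies.upperConst, Daubechies.mainTerm_eq hp]
    exact add_le_add_right (Daubechies.correction_pi_ge hp hm c) _
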